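/- Let $p$ be a prime and $n$ a positive integer. For $m\ge 1$, a divisor $k$ of $p^m-1$ is called a primitive divisor of $p^m-1$ if $k\nmid p^a-1$ for all integers $1\le a<m$. For a factorisation $p^m-1=dk$, where $k$ is even if $p$ is odd, let $\mathrm{GPaley}(p^m,k)$ be the (undirected) graph with vertex set $\mathbb{F}_{p^m}$ in which $x,y$ are adjacent if and only if $x-y$ is a $d$-th power in $\mathbb{F}_{p^m}^*$. The Cartesian product $\Gamma_1\,\square\cdots\square\,\Gamma_b$ of graphs is the graph on $V\Gamma_1\times\cdots\times V\Gamma_b$ in which two tuples are adjacent if and only if, for some $i$, their $i$-th entries are adjacent in $\Gamma_i$ and all their other entries agree; $\square^b\,\Gamma_0$ denotes the product of $b$ copies of $\Gamma_0$. A graph is Cartesian decomposable if it is isomorphic to $\Gamma_1\,\square\cdots\square\,\Gamma_b$ for some $b>1$ and graphs $\Gamma_i$ with at least two vertices each; it is Cartesian-prime if it has at least two vertices and is not Cartesian decomposable. Let $k$ be a primitive divisor of $p^n-1$, with $k$ even if $p$ is odd, and let $\Gamma=\mathrm{GPaley}(p^n,k)$. Then $\Gamma$ is connected, and the following are equivalent: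 (a) $\Gamma$ is Cartesian decomposable; (b) there are positive integers $b,c$ with $k=bc$, $b>1$, $b\mid n$, and $c$ a primitive divisor of $p^{n/b}-1$; (c) there are $b,c$ as in (b) such that $c$ is even if $p$ is odd, and $\Gamma\cong\square^b\,\Gamma_0$ with $\Gamma_0=\mathrm{GPaley}(p^{n/b},c)$. Moreover, for every pair $b,c$ as in (b), $c$ is even if $p$ is odd, and $\Gamma\cong\square^b\,\mathrm{GPaley}(p^{n/b},c)$. Finally, if $\Gamma$ is Cartesian decomposable, then there are $b,c$ as in (b), with $c$ even if $p$ is odd, such that $\Gamma_0=\mathrm{GPaley}(p^{n/b},c)$ is Cartesian-prime, $\Gamma\cong\square^b\,\Gamma_0$, and in every expression of $\Gamma$ (up to isomorphism) as a Cartesian product of finitely many Cartesian-prime graphs, every factor is isomorphic to $\Gamma_0$. -/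

import Mathlib

universe u v

/-- `k` is a primitive divisor of `p ^ n - 1`: it divides `p ^ n - 1`, but it divides no
`p ^ a - 1` with `1 ≤ a < n`. -/
def IsPrimitiveDivisor (p n k : ℕ) : Prop :=
  k ∣ p ^ n - 1 ∧ ∀ a : ℕ, 1 ≤ a → a < n → ¬ k ∣ p ^ a - 1

/-- The parameters for which the generalised Paley graph of valency `k` on the field of order
`p ^ n` is defined: `n` is positive, `k` divides `p ^ n - 1`, and `k` is even if `p` is odd. -/
structure IsGPaleyParameter (p n k : ℕ) : Prop where
  pos : 0 < n
  dvd : k ∣ p ^ n - 1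
  even : Odd p → Even k

/-- The condition `k even if p odd` makes `-1` a `d`-th power, where `p ^ n - 1 = d * k`. -/
theorem IsGPaleyParameter.exists_pow_eq_neg_one {p n k : ℕ} [Fact p.Prime]
    (h : IsGPaleyParameter p n k) :
    ∃ a : GaloisField p n, a ≠ 0 ∧ a ^ ((p ^ n - 1) / k) = -1 := by
  have hp : p.Prime := Fact.out
  rcases hp.eq_two_or_odd' with rfl | hodd
  · have : CharP (GaloisField 2 n) 2 := inferInstance
    exact ⟨1, one_ne_zero, by rw [one_pow, CharTwo.neg_eq]⟩
  · obtain ⟨m, hm⟩ := h.even hodd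
    obtain ⟨d, hd⟩ := h.dvd
    have hpn : 1 < p ^ n := Nat.one_lt_pow h.pos.ne' hp.one_lt
    have hk : 0 < k := by
      rcases Nat.eq_zero_or_pos k with rfl | hk
      · rw [zero_mul] at hd; omega
      · exact hk
    have hdpos : 0 < d := by
      rcases Nat.eq_zero_or_pos d with rfl | hd'
      · rw [mul_zero] at hd; omega
      · exact hd'
    have hq : (p ^ n - 1) / k = d := by rw [hd, Nat.mul_div_cancel_left _ hk]
    have hfin : Finite (GaloisField p n) :=
      Nat.finite_of_card_ne_zero (by rw [GaloisField.card p n h.pos.ne']; omega)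
    obtain ⟨g, hg⟩ := IsCyclic.exists_generator (α := (GaloisField p n)ˣ)
    have hord : orderOf g = k * d := by
      rw [orderOf_eq_card_of_forall_mem_zpowers hg, Nat.card_units,
        GaloisField.card p n h.pos.ne', hd]
    set x : GaloisField p n := ((g ^ m : (GaloisField p n)ˣ) : GaloisField p n) ^ d with hx
    have hx2 : x ^ 2 = 1 := by
      have : (g ^ m) ^ d * (g ^ m) ^ d = 1 := by
        rw [← pow_mul, ← pow_add, ← add_mul, ← hm, ← hord, pow_orderOf_eq_one]
      rw [hx, sq, ← Units.val_pow_eq_pow_val, ← Units.val_mul, this, Units.val_one]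
    have hx1 : x ≠ 1 := by
      intro h1
      have : g ^ (m * d) = 1 := by
        rw [pow_mul]; ext; rw [Units.val_pow_eq_pow_val, Units.val_one]; exact h1
      have hdvd := orderOf_dvd_of_pow_eq_one this
      have hmpos : 0 < m := by omega
      have := Nat.le_of_dvd (Nat.mul_pos hmpos hdpos) hdvd
      rw [hord] at this
      have := Nat.le_of_mul_le_mul_right this hdpos
      omega
    refine ⟨_, Units.ne_zero (g ^ m), ?_⟩
    rw [hq]
    exact (mul_self_eq_one_iff.1 (by rwa [← sq])).resolve_left hx1

/-- The generalised Paley graph `GPaley(p ^ n, k)`: with `p ^ n - 1 = d * k`, its vertices are the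
elements of the field of order `p ^ n`, and `x`, `y` are adjacent when `x - y` is the `d`-th power
of a nonzero field element. -/
def gPaley (p n k : ℕ) [Fact p.Prime] (h : IsGPaleyParameter p n k) :
    SimpleGraph (GaloisField p n) where
  Adj x y := ∃ a : GaloisField p n, a ≠ 0 ∧ a ^ ((p ^ n - 1) / k) = x - y
  symm := ⟨fun x y hxy => by
    obtain ⟨a, ha, hxy⟩ := hxy
    obtain ⟨e, he, hneg⟩ := h.exists_pow_eq_neg_one
    exact ⟨e * a, mul_ne_zero he ha, by rw [mul_pow, hneg, hxy]; ring⟩⟩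
  loopless := ⟨fun x hx => by
    obtain ⟨a, ha, hx⟩ := hx
    rw [sub_self] at hx
    exact pow_ne_zero _ ha hx⟩

/-- The Cartesian product of a family of graphs: two tuples are adjacent when they are adjacent in
one coordinate and equal in all the others. -/
def cartesianProduct {ι : Type u} {V : ι → Type v} (Γ : ∀ i, SimpleGraph (V i)) :
    SimpleGraph (∀ i, V i) where
  Adj x y := ∃ i, (Γ i).Adj (x i) (y i) ∧ ∀ j, j ≠ i → x j = y j
  symm := ⟨fun _ _ ⟨i, hi, hj⟩ => ⟨i, hi.symm, fun j hji => (hj j hji).symm⟩⟩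
  loopless := ⟨fun _ ⟨_, hi, _⟩ => hi.ne rfl⟩

/-- The `b`-th Cartesian power of a graph. -/
def cartesianPower (b : ℕ) {V : Type u} (Γ : SimpleGraph V) : SimpleGraph (Fin b → V) :=
  cartesianProduct fun _ : Fin b => Γ

/-- A graph is Cartesian decomposable if it is isomorphic to a Cartesian product of more than one
graph, each with at least two vertices. -/
def IsCartesianDecomposable {V : Type u} (Γ : SimpleGraph V) : Prop :=
  ∃ b : ℕ, 1 < b ∧ ∃ (W : Fin b → Type u) (Δ : ∀ i, SimpleGraph (W i)),
    (∀ i, Nontrivial (W i)) ∧ Nonempty (Γ ≃g cartesianProduct Δ)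

/-- A graph is Cartesian-prime if it has more than one vertex and is not Cartesian decomposable. -/
def IsCartesianPrime {V : Type u} (Γ : SimpleGraph V) : Prop :=
  Nontrivial V ∧ ¬ IsCartesianDecomposable Γ

/-! The graph is the Cayley graph on the additive group of the field F of order p^n whose connection
set S is the group of k-th roots of unity. S is multiplicatively closed, so its additive span is a
subring; primitivity of k makes that subring all of F, hence connectedness.

From (b), take g of order k and the subfield L of order p^(n/b). Then g^b generates the c-th roots
of unity of L, and (z_i) ↦ Σ z_i g^i is a bijection L^b → F carrying the union of the coordinate
copies of these roots onto S. This is the isomorphism of `gPaley_iso_cartesianPower`.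

Conversely, layers of a product are geodesically convex, which makes the layers of a prime
factorization of a connected graph unique (`SameLayer.exists_forall_iff`); automorphisms therefore
permute its b directions. Multiplication by S is transitive on directions, so b divides k and p does
not divide b. The p-group of translations then fixes one direction and, being normalized by S, every
direction. The layer through 0 and 1 is thus an additive subgroup. It is spanned by the roots of
unity in it, which stabilize its direction and number c = k/b; so it is a subfield, of order
p^(n/b), and c is a primitive divisor (`gPaley_prime_factorization`). Comparing layers identifies
the prime factors with the smaller Paley graph. -/

namespace cartesianProduct

/-! ### Cartesian products, connectedness and distance -/

variable {ι : Type*} {V : ι → Type*} {Γ : ∀ i, SimpleGraph (V i)}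

theorem adj_update [DecidableEq ι] (x : ∀ i, V i) (i : ι) {a b : V i} (h : (Γ i).Adj a b) :
    (cartesianProduct Γ).Adj (Function.update x i a) (Function.update x i b) :=
  ⟨i, by simpa using h, fun j hj => by simp [hj]⟩

/-- The embedding of a factor onto the layer through a given vertex. -/
def layer [DecidableEq ι] (x : ∀ i, V i) (i : ι) : Γ i ↪g cartesianProduct Γ where
  toFun := Function.update x i
  inj' := Function.update_injective x i
  map_rel_iff' := by
    intro a b
    refine ⟨?_, adj_update x i⟩
    rintro ⟨j, hj, hne⟩
    by_cases hij : j = i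
    · subst hij; simpa using hj
    · exact absurd hj (by simp [hij])

/-- Isomorphic factors give isomorphic products. -/
def congr {W : ι → Type*} {Δ : ∀ i, SimpleGraph (W i)} (f : ∀ i, Γ i ≃g Δ i) :
    cartesianProduct Γ ≃g cartesianProduct Δ where
  toEquiv := Equiv.piCongrRight fun i => (f i).toEquiv
  map_rel_iff' := by
    intro x y
    refine exists_congr fun i => and_congr (f i).map_adj_iff (forall₂_congr fun j _ => ?_)
    exact (f j).injective.eq_iff

/-- Reindexing a product. -/
def reindex {κ : Type*} (e : κ ≃ ι) :
    cartesianProduct Γ ≃g cartesianProduct fun k => Γ (e k) where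
  toEquiv := (Equiv.piCongrLeft V e).symm
  map_rel_iff' := by
    intro x y
    constructor
    · rintro ⟨k, hk, h⟩
      refine ⟨e k, hk, fun j hj => ?_⟩
      obtain ⟨l, rfl⟩ := e.surjective j
      exact h l fun hl => hj (by rw [hl])
    · rintro ⟨i, hi, h⟩
      obtain ⟨k, rfl⟩ := e.surjective i
      exact ⟨k, hi, fun l hl => h _ fun hk => hl (e.injective hk)⟩

/-- A product of products is the product over the sigma type. -/
def sigma {κ : ι → Type*} {W : (Σ i, κ i) → Type*} (Δ : ∀ s, SimpleGraph (W s)) :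
    cartesianProduct Δ ≃g cartesianProduct fun i => cartesianProduct fun j => Δ ⟨i, j⟩ where
  toEquiv := Equiv.piCurry fun i j => W ⟨i, j⟩
  map_rel_iff' := by
    intro x y
    constructor
    · rintro ⟨i, ⟨j, hj, h⟩, h'⟩
      refine ⟨⟨i, j⟩, hj, fun s hs => ?_⟩
      obtain ⟨i', j'⟩ := s
      by_cases hi : i' = i
      · subst hi
        exact h j' fun hj' => hs (by rw [hj'])
      · exact congrFun (h' i' hi) j'
    · rintro ⟨⟨i, j⟩, hj, h⟩
      refine ⟨i, ⟨j, hj, fun j' hj' => h ⟨i, j'⟩ fun hs => hj' ?_⟩, fun i' hi' => ?_⟩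
      · simpa using hs
      · funext j'
        exact h ⟨i', j'⟩ fun hs => hi' (congrArg Sigma.fst hs)

theorem connected_factor [∀ i, Nonempty (V i)] (h : (cartesianProduct Γ).Connected) (i : ι) :
    (Γ i).Connected := by
  classical
  have key : ∀ x y : ∀ i, V i, (cartesianProduct Γ).Reachable x y →
      (Γ i).Reachable (x i) (y i) := by
    rintro x y ⟨w⟩
    induction w with
    | nil => rfl
    | cons hadj _ ih =>
      refine SimpleGraph.Reachable.trans ?_ ih
      obtain ⟨j, hj, hne⟩ := hadj
      by_cases hij : i = j
      · subst hij; exact hj.reachable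
      · rw [hne i hij]
  have x : ∀ i, V i := fun i => Classical.arbitrary _
  refine (SimpleGraph.connected_iff _).2 ⟨fun a b => ?_, inferInstance⟩
  simpa using key (Function.update x i a) (Function.update x i b) (h.preconnected _ _)

theorem dist_update_le [DecidableEq ι] (h : ∀ i, (Γ i).Connected) (x : ∀ i, V i) (i : ι)
    (a : V i) : (cartesianProduct Γ).dist x (Function.update x i a) ≤ (Γ i).dist (x i) a := by
  obtain ⟨w, hw⟩ := (h i).exists_walk_length_eq_dist (x i) a
  have := SimpleGraph.dist_le (w.map (layer (Γ := Γ) x i).toHom)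
  rw [SimpleGraph.Walk.length_map, hw] at this
  simpa [layer] using this

theorem reachable_of_connected [Finite ι] (h : ∀ i, (Γ i).Connected) :
    (cartesianProduct Γ).Preconnected := by
  classical
  have := Fintype.ofFinite ι
  have key : ∀ (s : Finset ι) (x y : ∀ i, V i), (∀ i ∉ s, x i = y i) →
      (cartesianProduct Γ).Reachable x y := by
    intro s
    induction s using Finset.induction_on with
    | empty => intro x y hxy; rw [funext fun i => hxy i (by simp)]
    | insert i s hi ih =>
      intro x y hxy
      obtain ⟨w⟩ := (h i).preconnected (x i) (y i)
      have h1 : (cartesianProduct Γ).Reachable x (Function.update x i (y i)) := by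
        simpa [layer] using (w.map (layer (Γ := Γ) x i).toHom).reachable
      refine h1.trans (ih _ _ fun j hj => ?_)
      by_cases hji : j = i
      · subst hji; simp
      · simpa [hji] using hxy j (by simp [hji, hj])
  exact fun x y => key Finset.univ x y (by simp)

/-- Correcting coordinates one at a time along geodesics gives `≤`. For `≥`, an edge changes a
single coordinate, so it lowers the sum by at most one. -/
theorem dist_eq_sum [Fintype ι] (h : ∀ i, (Γ i).Connected) (x y : ∀ i, V i) :
    (cartesianProduct Γ).dist x y = ∑ i, (Γ i).dist (x i) (y i) := by
  classical
  have hreach := reachable_of_connected h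
  apply le_antisymm
  · have key : ∀ (s : Finset ι) (x : ∀ i, V i), (∀ i ∉ s, x i = y i) →
        (cartesianProduct Γ).dist x y ≤ ∑ i ∈ s, (Γ i).dist (x i) (y i) := by
      intro s
      induction s using Finset.induction_on with
      | empty => intro x hxy; rw [funext fun i => hxy i (by simp)]; simp
      | insert i s hi ih =>
        intro x hxy
        have h1 := dist_update_le h x i (y i)
        have h2 := ih (Function.update x i (y i)) fun j hj => by
          by_cases hji : j = i
          · subst hji; simp
          · simpa [hji] using hxy j (by simp [hji, hj])
        have h3 : ∑ j ∈ s, (Γ j).dist (Function.update x i (y i) j) (y j) =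
            ∑ j ∈ s, (Γ j).dist (x j) (y j) :=
          Finset.sum_congr rfl fun j hj => by
            rw [Function.update_of_ne (fun e : j = i => hi (e ▸ hj))]
        rw [Finset.sum_insert hi]
        obtain ⟨w₁, hw₁⟩ := (hreach x (Function.update x i (y i))).exists_walk_length_eq_dist
        obtain ⟨w₂, hw₂⟩ := (hreach (Function.update x i (y i)) y).exists_walk_length_eq_dist
        have h4 := SimpleGraph.dist_le (w₁.append w₂)
        rw [SimpleGraph.Walk.length_append] at h4
        omega
    exact key Finset.univ x (by simp)
  · obtain ⟨w, hw⟩ := (hreach x y).exists_walk_length_eq_dist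
    rw [← hw]
    clear hw
    induction w with
    | nil => simp
    | @cons a b c hadj w ih =>
      rw [SimpleGraph.Walk.length_cons]
      obtain ⟨i, hi, hne⟩ := hadj
      refine le_trans ?_ (Nat.add_le_add_right ih 1)
      rw [← Finset.add_sum_erase _ _ (Finset.mem_univ i), ← Finset.add_sum_erase
        (f := fun j => (Γ j).dist (b j) (c j)) _ (Finset.mem_univ i)]
      have h1 := (h i).dist_triangle (u := a i) (v := b i) (w := c i)
      rw [SimpleGraph.dist_eq_one_iff_adj.2 hi] at h1
      have h2 : ∑ j ∈ Finset.univ.erase i, (Γ j).dist (a j) (c j) =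
          ∑ j ∈ Finset.univ.erase i, (Γ j).dist (b j) (c j) :=
        Finset.sum_congr rfl fun j hj => by rw [hne j (Finset.ne_of_mem_erase hj)]
      omega

/-- Geodesic intervals in a product are the products of the geodesic intervals. -/
theorem dist_add_dist_eq_iff [Fintype ι] (h : ∀ i, (Γ i).Connected) (x y z : ∀ i, V i) :
    (cartesianProduct Γ).dist x y + (cartesianProduct Γ).dist y z = (cartesianProduct Γ).dist x z ↔
      ∀ i, (Γ i).dist (x i) (y i) + (Γ i).dist (y i) (z i) = (Γ i).dist (x i) (z i) := by
  simp only [dist_eq_sum h, ← Finset.sum_add_distrib]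
  constructor
  · intro heq i
    exact ((Finset.sum_eq_sum_iff_of_le fun j _ => (h j).dist_triangle).1 heq.symm i
      (Finset.mem_univ i)).symm
  · exact fun heq => Finset.sum_congr rfl fun i _ => heq i

end cartesianProduct

/-! ### Decomposability and existence of prime factorizations -/

theorem isCartesianDecomposable_of_iso {V : Type u} {Γ : SimpleGraph V} {ι : Type*} [Finite ι]
    [Nontrivial ι] {W : ι → Type u} {Δ : ∀ i, SimpleGraph (W i)} (hW : ∀ i, Nontrivial (W i))
    (φ : Γ ≃g cartesianProduct Δ) : IsCartesianDecomposable Γ := by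
  have := Fintype.ofFinite ι
  exact ⟨Fintype.card ι, Fintype.one_lt_card, _, _, fun i => hW _,
    ⟨φ.trans (cartesianProduct.reindex (Fintype.equivFin ι).symm)⟩⟩

theorem IsCartesianDecomposable.of_iso {V W : Type u} {Γ : SimpleGraph V} {Δ : SimpleGraph W}
    (e : Γ ≃g Δ) (h : IsCartesianDecomposable Δ) : IsCartesianDecomposable Γ := by
  obtain ⟨b, hb, X, E, hX, ⟨φ⟩⟩ := h
  exact ⟨b, hb, X, E, hX, ⟨e.trans φ⟩⟩

theorem IsCartesianPrime.of_iso {V W : Type u} {Γ : SimpleGraph V} {Δ : SimpleGraph W}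
    (e : Γ ≃g Δ) (h : IsCartesianPrime Γ) : IsCartesianPrime Δ :=
  ⟨have := h.1; e.symm.toEquiv.nontrivial, fun hd => h.2 (hd.of_iso e)⟩

/-- Every nontrivial finite graph is a product of Cartesian-prime graphs. -/
theorem exists_prime_factorization {V : Type u} [Finite V] [Nontrivial V] (Γ : SimpleGraph V) :
    ∃ (m : ℕ) (W : Fin m → Type u) (Δ : ∀ i, SimpleGraph (W i)),
      (∀ i, IsCartesianPrime (Δ i)) ∧ Nonempty (Γ ≃g cartesianProduct Δ) := by
  induction hN : Nat.card V using Nat.strong_induction_on generalizing V with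
  | _ N ih =>
  by_cases hd : IsCartesianDecomposable Γ
  · obtain ⟨b, hb, W, Δ, hW, ⟨φ⟩⟩ := hd
    have hfin : ∀ i, Finite (W i) := fun i =>
      Finite.of_injective _ (cartesianProduct.layer (Γ := Δ)
        (fun i => Classical.arbitrary (W i)) i |>.trans φ.symm.toRelEmbedding).injective
    have hcard : ∀ i, Nat.card (W i) < N := by
      intro i
      rw [← hN, Nat.card_congr φ.toEquiv, Nat.card_pi, ← Finset.mul_prod_erase _ _
        (Finset.mem_univ i)]
      refine (lt_mul_iff_one_lt_right Nat.card_pos).2 ?_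
      have : Nontrivial (Fin b) := Fin.nontrivial_iff_two_le.2 hb
      obtain ⟨j, hj⟩ := exists_ne i
      -- A second factor `W j` already makes the remaining product exceed 1.
      rw [← Finset.mul_prod_erase _ _ (Finset.mem_erase.2 ⟨hj, Finset.mem_univ j⟩)]
      refine lt_of_lt_of_le Finite.one_lt_card (Nat.le_mul_of_pos_right (Nat.card (W j)) ?_)
      exact Finset.prod_pos fun l _ => Nat.card_pos
    choose m X E hE ψ using fun i => ih _ (hcard i) (Δ i) rfl
    let Y : (Σ i, Fin (m i)) → Type u := fun s => X s.1 s.2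
    let D : ∀ s, SimpleGraph (Y s) := fun s => E s.1 s.2
    let e := (Fintype.equivFin (Σ i, Fin (m i))).symm
    exact ⟨_, fun i => Y (e i), fun i => D (e i), fun i => hE _ _,
      ⟨(φ.trans (cartesianProduct.congr fun i => (ψ i).some)).trans
        ((cartesianProduct.sigma D).symm.trans (cartesianProduct.reindex e))⟩⟩
  · refine ⟨1, fun _ => V, fun _ => Γ, fun _ => ⟨inferInstance, hd⟩, ⟨⟨(Equiv.funUnique (Fin 1) V).symm, ?_⟩⟩⟩
    intro x y
    simp [cartesianProduct, Equiv.funUnique]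

theorem dist_iso {V W : Type*} {G : SimpleGraph V} {H : SimpleGraph W} (φ : G ≃g H) (u v : V) :
    H.dist (φ u) (φ v) = G.dist u v := by
  by_cases h : G.Reachable u v
  · apply le_antisymm
    · obtain ⟨w, hw⟩ := h.exists_walk_length_eq_dist
      rw [← hw, ← w.length_map φ.toHom]
      exact SimpleGraph.dist_le _
    · obtain ⟨w, hw⟩ := (h.map φ.toHom).exists_walk_length_eq_dist
      have := SimpleGraph.dist_le (w.map φ.symm.toHom)
      rw [SimpleGraph.Walk.length_map, hw] at this
      simpa using this
  · rw [SimpleGraph.dist_eq_zero_of_not_reachable h,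
      SimpleGraph.dist_eq_zero_of_not_reachable fun h' => h (φ.reachable_iff.1 h')]

/-! ### Layers and uniqueness of prime factorization -/

/-- An induced embedding of a Cartesian-prime graph into a product, whose range is closed under
replacing coordinates, has its range in a single layer. -/
theorem IsCartesianPrime.exists_layer {U : Type u} {Δ : SimpleGraph U} (hΔ : IsCartesianPrime Δ)
    {κ : Type*} [Finite κ] [DecidableEq κ] {W : κ → Type u} {E : ∀ j, SimpleGraph (W j)}
    (f : Δ ↪g cartesianProduct E)
    (hf : ∀ a b j, ∃ c, f c = Function.update (f a) j (f b j)) :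
    ∃ j, ∀ a b, ∀ l, l ≠ j → f a l = f b l := by
  classical
  have := Fintype.ofFinite κ
  -- The range is a full box: any mixture of coordinates of its points is again in it.
  have hbox : ∀ (g : κ → U) (a : U) (s : Finset κ),
      ∃ c, ∀ j, f c j = if j ∈ s then f (g j) j else f a j := by
    intro g a s
    induction s using Finset.induction_on with
    | empty => exact ⟨a, by simp⟩
    | insert i s hi ih =>
      obtain ⟨c, hc⟩ := ih
      obtain ⟨d, hd⟩ := hf c (g i) i
      refine ⟨d, fun j => ?_⟩
      by_cases hji : j = i
      · subst hji; simp [hd]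
      · simp [hd, hji, hc]
  let P : ∀ j, Set (W j) := fun j => Set.range fun a => f a j
  let J := {j // (P j).Nontrivial}
  have hconst : ∀ j, ¬ (P j).Nontrivial → ∀ a b, f a j = f b j := fun j hj a b =>
    Set.not_nontrivial_iff.1 hj ⟨a, rfl⟩ ⟨b, rfl⟩
  by_contra hcon
  push Not at hcon
  obtain ⟨u, v, huv⟩ := hΔ.1
  obtain ⟨j₀, hj₀⟩ : ∃ j, f u j ≠ f v j := by
    by_contra h
    push Not at h
    exact huv (f.injective (funext h))
  obtain ⟨a, b, j₁, hj₁, hab⟩ := hcon j₀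
  -- Two nonconstant coordinates would write `Δ` as the product of its projections to the
  -- coordinates in `J`.
  have hJ : Nontrivial J :=
    ⟨⟨j₀, _, ⟨u, rfl⟩, _, ⟨v, rfl⟩, hj₀⟩, ⟨j₁, _, ⟨a, rfl⟩, _, ⟨b, rfl⟩, hab⟩,
      fun h => hj₁ (congrArg Subtype.val h).symm⟩
  let F : U → ∀ j : J, P j.1 := fun a j => ⟨f a j, a, rfl⟩
  have hF : Function.Bijective F := by
    constructor
    · intro a b h
      refine f.injective (funext fun j => ?_)
      by_cases hj : (P j).Nontrivial
      · exact congrArg Subtype.val (congrFun h ⟨j, hj⟩)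
      · exact hconst j hj a b
    · intro t
      choose g hg using fun j : J => (t j).2
      obtain ⟨c, hc⟩ := hbox (fun j => if hj : (P j).Nontrivial then g ⟨j, hj⟩ else u) u Finset.univ
      refine ⟨c, funext fun j => Subtype.ext ?_⟩
      rw [← hg j]
      simpa [j.2] using hc j
  refine hΔ.2 (isCartesianDecomposable_of_iso (ι := J) (W := fun j => P j.1)
    (Δ := fun j => (E j.1).induce (P j.1)) (fun j => j.2.coe_sort)
    ⟨Equiv.ofBijective F hF, ?_⟩)
  intro a b
  refine Iff.trans ?_ f.map_adj_iff
  constructor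
  · rintro ⟨j, hj, h⟩
    refine ⟨j, hj, fun l hl => ?_⟩
    by_cases hlP : (P l).Nontrivial
    · exact congrArg Subtype.val (h ⟨l, hlP⟩ fun e => hl (congrArg Subtype.val e))
    · exact hconst l hlP a b
  · rintro ⟨j, hj, h⟩
    refine ⟨⟨j, _, ⟨a, rfl⟩, _, ⟨b, rfl⟩, hj.ne⟩, hj, fun l hl => Subtype.ext (h l fun e => hl ?_)⟩
    exact Subtype.ext e

/-- Two vertices lie in a common `i`-layer of a product when they agree outside coordinate `i`. -/
def SameLayer {V : Type*} {ι : Type*} {W : ι → Type*} {G : SimpleGraph V}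
    {Δ : ∀ i, SimpleGraph (W i)} (φ : G ≃g cartesianProduct Δ) (i : ι) (x y : V) : Prop :=
  ∀ j, j ≠ i → φ x j = φ y j

namespace SameLayer

section basic

variable {V : Type*} {ι : Type*} {W : ι → Type*} {G : SimpleGraph V}
    {Δ : ∀ i, SimpleGraph (W i)} {φ : G ≃g cartesianProduct Δ} {i j : ι} {x y z : V}

theorem refl (φ : G ≃g cartesianProduct Δ) (i : ι) (x : V) : SameLayer φ i x x := fun _ _ => rfl

theorem symm (h : SameLayer φ i x y) : SameLayer φ i y x := fun j hj => (h j hj).symm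

theorem trans (h : SameLayer φ i x y) (h' : SameLayer φ i y z) : SameLayer φ i x z :=
  fun j hj => (h j hj).trans (h' j hj)

/-- Layers in different directions share at most one vertex, so two distinct vertices determine
their direction. -/
theorem eq_index (hne : x ≠ y) (h : SameLayer φ i x y) (h' : SameLayer φ j x y) : i = j := by
  by_contra hij
  refine hne (φ.injective (funext fun l => ?_))
  by_cases hl : l = i
  · exact h' l fun e => hij (hl.symm.trans e)
  · exact h l hl

theorem exists_of_adj (φ : G ≃g cartesianProduct Δ) (h : G.Adj x y) : ∃ i, SameLayer φ i x y := by
  obtain ⟨i, -, hi⟩ := φ.map_adj_iff.2 h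
  exact ⟨i, hi⟩

theorem iff_exists_update [DecidableEq ι] :
    SameLayer φ i x y ↔ ∃ a, y = φ.symm (Function.update (φ x) i a) := by
  constructor
  · intro h
    refine ⟨φ y i, φ.injective ?_⟩
    rw [φ.apply_symm_apply]
    funext j
    by_cases hj : j = i
    · subst hj; simp
    · simpa [hj] using (h j hj).symm
  · rintro ⟨a, rfl⟩ j hj
    simp [hj]

theorem exists_ne [∀ i, Nontrivial (W i)] (φ : G ≃g cartesianProduct Δ) (i : ι) (x : V) :
    ∃ y, y ≠ x ∧ SameLayer φ i x y := by
  classical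
  obtain ⟨a, ha⟩ := _root_.exists_ne (φ x i)
  refine ⟨φ.symm (Function.update (φ x) i a), fun h => ha ?_, iff_exists_update.2 ⟨a, rfl⟩⟩
  have := congrFun (congrArg φ h) i
  simpa using this

/-- Layers are geodesically convex. -/
theorem of_dist [Finite ι] (hΔ : ∀ i, (Δ i).Connected) (h : SameLayer φ i x z)
    (hd : G.dist x y + G.dist y z = G.dist x z) : SameLayer φ i x y := by
  have := Fintype.ofFinite ι
  have hφ : ∀ u v, (cartesianProduct Δ).dist (φ u) (φ v) = G.dist u v := fun u v => dist_iso φ u v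
  rw [← hφ, ← hφ, ← hφ, cartesianProduct.dist_add_dist_eq_iff hΔ] at hd
  intro j hj
  -- Where `x` and `z` agree the right side is 0, so both distances on the left vanish.
  have h1 := hd j
  rw [← h j hj, SimpleGraph.dist_self] at h1
  exact ((hΔ j).dist_eq_zero_iff).1 (by omega)

/-- Connectedness of layers, as an induction principle. -/
theorem induction (hΔ : ∀ i, (Δ i).Connected) (i : ι) (x : V) {P : V → Prop} (h0 : P x)
    (hstep : ∀ y z, SameLayer φ i x y → SameLayer φ i x z → G.Adj y z → P y → P z) (y : V)
    (hy : SameLayer φ i x y) : P y := by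
  classical
  have key : ∀ a b (w : (Δ i).Walk a b), P (φ.symm (Function.update (φ x) i a)) →
      P (φ.symm (Function.update (φ x) i b)) := by
    intro a b w
    induction w with
    | nil => exact id
    | cons hadj _ ih =>
      intro h
      refine ih (hstep _ _ (iff_exists_update.2 ⟨_, rfl⟩) (iff_exists_update.2 ⟨_, rfl⟩) ?_ h)
      exact φ.symm.map_adj_iff.2 (cartesianProduct.adj_update _ _ hadj)
  obtain ⟨a, rfl⟩ := iff_exists_update.1 hy
  obtain ⟨w⟩ := (hΔ i).preconnected (φ x i) a
  exact key _ _ w (by simpa using h0)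

/-- Each factor is isomorphic to the graph induced on any of its layers. -/
noncomputable def induceIso [DecidableEq ι] (φ : G ≃g cartesianProduct Δ) (i : ι) (x : V) :
    Δ i ≃g G.induce {y | SameLayer φ i x y} where
  toEquiv := Equiv.ofBijective
    (fun a => ⟨φ.symm (Function.update (φ x) i a), iff_exists_update.2 ⟨a, rfl⟩⟩) (by
      constructor
      · intro a b h
        exact Function.update_injective _ _ (φ.symm.injective (congrArg Subtype.val h))
      · rintro ⟨y, hy⟩
        obtain ⟨a, rfl⟩ := iff_exists_update.1 hy
        exact ⟨a, rfl⟩)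
  map_rel_iff' := by
    intro a b
    exact φ.symm.map_adj_iff.trans (cartesianProduct.layer (φ x) i).map_adj_iff

theorem comp_iso {α : G ≃g G} : SameLayer (α.trans φ) i x y ↔ SameLayer φ i (α x) (α y) := Iff.rfl

end basic

section prime

variable {V : Type u} {G : SimpleGraph V} {ι κ : Type*} [Finite ι] [Finite κ]
  {W : ι → Type u} {Δ : ∀ i, SimpleGraph (W i)} {X : κ → Type u} {E : ∀ j, SimpleGraph (X j)}

theorem connected_factor {ι : Type*} {W : ι → Type u} {Δ : ∀ i, SimpleGraph (W i)} (hG : G.Connected) (hW : ∀ i, Nonempty (W i))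
    (φ : G ≃g cartesianProduct Δ) (i : ι) : (Δ i).Connected :=
  cartesianProduct.connected_factor (φ.connected_iff.1 hG) i

/-- A layer of a Cartesian-prime factor lies in a layer of any other factorization. -/
theorem exists_le (hG : G.Connected) (hW : ∀ i, Nonempty (W i)) (hX : ∀ j, Nonempty (X j))
    (φ : G ≃g cartesianProduct Δ) (ψ : G ≃g cartesianProduct E) (i : ι)
    (hi : IsCartesianPrime (Δ i)) (x : V) :
    ∃ j, ∀ y, SameLayer φ i x y → SameLayer ψ j x y := by
  classical
  have hΔ := connected_factor hG hW φ
  have hE := connected_factor hG hX ψ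
  have := Fintype.ofFinite κ
  let f : Δ i ↪g cartesianProduct E :=
    ((cartesianProduct.layer (φ x) i).trans φ.symm.toRelEmbedding).trans ψ.toRelEmbedding
  have hψ : ∀ u v, (cartesianProduct E).dist (ψ u) (ψ v) = G.dist u v := fun u v => dist_iso ψ u v
  have hfa : ∀ a, f a = ψ (φ.symm (Function.update (φ x) i a)) := fun _ => rfl
  obtain ⟨j, hj⟩ := hi.exists_layer f fun a b j => by
    set y := φ.symm (Function.update (φ x) i a) with hy
    set z := φ.symm (Function.update (φ x) i b) with hz
    have hyL : SameLayer φ i x y := iff_exists_update.2 ⟨a, rfl⟩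
    have hzL : SameLayer φ i x z := iff_exists_update.2 ⟨b, rfl⟩
    -- Each coordinate of `w` is taken from `y` or `z`, so `w` lies on a geodesic between them, and
    -- convexity keeps it in the `φ`-layer.
    set w := ψ.symm (Function.update (ψ y) j (ψ z j)) with hw
    have hwd : G.dist y w + G.dist w z = G.dist y z := by
      rw [← hψ, ← hψ, ← hψ, cartesianProduct.dist_add_dist_eq_iff hE]
      intro l
      by_cases hl : l = j
      · subst hl; simp [hw]
      · simp [hw, hl]
    obtain ⟨c, hc⟩ := iff_exists_update.1 (hyL.trans (of_dist hΔ (hyL.symm.trans hzL) hwd))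
    refine ⟨c, ?_⟩
    rw [hfa, ← hc, hw, ψ.apply_symm_apply]
    rfl
  refine ⟨j, fun y hy l hl => ?_⟩
  obtain ⟨a, rfl⟩ := iff_exists_update.1 hy
  have := hj (φ x i) a l hl
  simpa [hfa] using this

/-- Layers of two factorizations into Cartesian-prime graphs agree. -/
theorem exists_iff (hG : G.Connected) (hΔ : ∀ i, IsCartesianPrime (Δ i))
    (hE : ∀ j, IsCartesianPrime (E j)) (φ : G ≃g cartesianProduct Δ) (ψ : G ≃g cartesianProduct E)
    (i : ι) (x : V) : ∃ j, ∀ y, SameLayer φ i x y ↔ SameLayer ψ j x y := by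
  have hW : ∀ i, Nontrivial (W i) := fun i => (hΔ i).1
  have hX : ∀ j, Nontrivial (X j) := fun j => (hE j).1
  obtain ⟨j, hj⟩ := exists_le hG (fun i => inferInstance) (fun i => inferInstance) φ ψ i (hΔ i) x
  obtain ⟨i', hi'⟩ := exists_le hG (fun i => inferInstance) (fun i => inferInstance) ψ φ j (hE j) x
  obtain ⟨y, hyx, hy⟩ := exists_ne φ i x
  obtain rfl := eq_index hyx.symm hy (hi' y (hj y hy))
  exact ⟨j, fun y => ⟨hj y, hi' y⟩⟩

/-- Two factorizations of a connected graph into Cartesian-prime graphs have the same layers. -/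
theorem exists_forall_iff (hG : G.Connected) (hΔ : ∀ i, IsCartesianPrime (Δ i))
    (hE : ∀ j, IsCartesianPrime (E j)) (φ : G ≃g cartesianProduct Δ) (ψ : G ≃g cartesianProduct E)
    (i : ι) : ∃ j, ∀ x y, SameLayer φ i x y ↔ SameLayer ψ j x y := by
  classical
  have hW : ∀ i, Nontrivial (W i) := fun i => (hΔ i).1
  -- `J x i` is the `ψ`-direction matching `i` at `x`; it remains to see that it does not depend on
  -- `x`.
  choose J hJ using fun (x : V) (i : ι) => exists_iff hG hΔ hE φ ψ i x
  have hJeq : ∀ {x y i j}, x ≠ y → SameLayer φ i x y → SameLayer ψ j x y → J x i = j :=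
    fun hne h h' => eq_index hne ((hJ _ _ _).1 h) h'
  have hJeq' : ∀ {x y i}, x ≠ y → SameLayer φ i x y → SameLayer ψ (J y i) x y :=
    fun hne h => ((hJ _ _ _).1 h.symm).symm
  have step : ∀ x y l, x ≠ y → SameLayer φ l x y → ∀ i, J x i = J y i := by
    intro x y l hxy hl i
    by_cases hil : i = l
    · subst hil
      exact hJeq hxy hl (hJeq' hxy hl)
    obtain ⟨z, hzx, hz⟩ := exists_ne φ i x
    -- the fourth corner of the square on `x`, `y`, `z`
    set w := φ.symm (Function.update (φ y) i (φ z i)) with hw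
    have hyw : SameLayer φ i y w := iff_exists_update.2 ⟨_, rfl⟩
    have hzw : SameLayer φ l z w := by
      intro j hj
      by_cases hji : j = i
      · subst hji; simp [hw]
      · simp only [hw, RelIso.apply_symm_apply, ne_eq, hji, not_false_eq_true,
          Function.update_of_ne]
        rw [← hl j hj, hz j hji]
    have hyw' : y ≠ w := fun h => hzx.symm <| by
      refine φ.injective (funext fun j => ?_)
      by_cases hj : j = i
      · subst hj
        have h2 : φ w j = φ z j := by simp [hw]
        rw [hl j hil, h, h2]
      · exact hz j hj
    have hxw : x ≠ w := fun h => hil (eq_index hyw' hyw (h ▸ hl.symm))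
    have hxy' : ∀ j, j ≠ J x l → ψ x j = ψ y j := (hJ x l y).1 hl
    have hxz' : ∀ j, j ≠ J x i → ψ x j = ψ z j := (hJ x i z).1 hz
    have hyw'' : ∀ j, j ≠ J y i → ψ y j = ψ w j := (hJ y i w).1 hyw
    have hzw'' : ∀ j, j ≠ J z l → ψ z j = ψ w j := (hJ z l w).1 hzw
    have hne : J x i ≠ J x l := fun h => hil <| by
      refine eq_index hxy ((hJ x i y).2 ?_) hl
      rw [h]; exact hxy'
    have hne_of : ∀ {u j}, x ≠ u → (∀ l, l ≠ j → ψ x l = ψ u l) → ψ x j ≠ ψ u j := by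
      intro u j hxu h he
      refine hxu (ψ.injective (funext fun l => ?_))
      by_cases hl : l = j
      · rw [hl, he]
      · exact h l hl
    have h₁ : ψ y (J x i) ≠ ψ z (J x i) := by
      rw [← hxy' _ hne]; exact hne_of hzx.symm hxz'
    have h₀ : ψ y (J x l) ≠ ψ z (J x l) := by
      rw [← hxz' _ hne.symm]; exact (hne_of hxy hxy').symm
    -- The two coordinates where `y` and `z` differ, seen through `x`, must be those seen through
    -- `w`. If they were swapped, `w` would coincide with `x`.
    have hmem : ∀ j, ψ y j ≠ ψ z j → j = J y i ∨ j = J z l := by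
      intro j hj
      by_contra h
      push Not at h
      exact hj ((hyw'' j h.1).trans (hzw'' j h.2).symm)
    by_contra hcon
    have e₁ := (hmem _ h₁).resolve_left hcon
    have e₀ := (hmem _ h₀).resolve_right fun h => hne (e₁.trans h.symm)
    refine hxw (ψ.injective (funext fun j => ?_))
    by_cases hj : j = J x l
    · rw [hj, hxz' _ hne.symm, hzw'' _ (by rw [← e₁]; exact hne.symm)]
    · rw [hxy' j hj, hyw'' j (by rwa [← e₀])]
  have hconst : ∀ x y, J x i = J y i := by
    intro x y
    obtain ⟨w⟩ := hG.preconnected x y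
    induction w with
    | nil => rfl
    | cons hadj _ ih =>
      obtain ⟨l, hl⟩ := exists_of_adj φ hadj
      exact (step _ _ l hadj.ne hl i).trans ih
  obtain ⟨x₀⟩ := hG.nonempty
  exact ⟨J x₀ i, fun x y => hconst x₀ x ▸ hJ x i y⟩

end prime

end SameLayer

/-! ### Roots of unity and subrings of finite fields -/

section field

variable {F : Type*} [Field F] [Finite F]

theorem exists_isPrimitiveRoot_of_dvd {k : ℕ} (hk : k ∣ Nat.card F - 1) :
    ∃ ζ : F, IsPrimitiveRoot ζ k := by
  obtain ⟨g, hg⟩ := IsCyclic.exists_generator (α := Fˣ)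
  have h : IsPrimitiveRoot (g : F) (Nat.card F - 1) := by
    rw [← Nat.card_units, ← orderOf_eq_card_of_forall_mem_zpowers hg, ← orderOf_units]
    exact IsPrimitiveRoot.orderOf _
  obtain ⟨d, hd⟩ := hk
  exact ⟨_, h.pow (Nat.sub_pos_of_lt Finite.one_lt_card) (hd.trans (mul_comm _ _))⟩

/-- A finite domain is a field, here of characteristic `p`. -/
theorem Subring.exists_card_eq_pow (p : ℕ) [Fact p.Prime] [CharP F p] (A : Subring F) :
    ∃ a : ℕ, 0 < a ∧ Nat.card A = p ^ a ∧ ∀ x ∈ A, x ^ p ^ a = x := by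
  classical
  have := Fintype.ofFinite A
  let _ : Field A := Fintype.fieldOfDomain A
  have : CharP A p := (Subring.subtype A).charP Subtype.val_injective p
  obtain ⟨a, -, ha⟩ := FiniteField.card A p
  refine ⟨a, a.pos, by rw [Nat.card_eq_fintype_card, ha], fun x hx => ?_⟩
  rw [← ha]
  exact congrArg Subtype.val (FiniteField.pow_card (⟨x, hx⟩ : A))

/-- The roots of unity of order `k`, a primitive divisor of `p ^ n - 1`, span the field of order
`p ^ n` additively. -/
theorem IsPrimitiveDivisor.closure_eq_top {p n k : ℕ} [Fact p.Prime] [CharP F p]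
    (hF : Nat.card F = p ^ n) (hk : IsPrimitiveDivisor p n k) :
    AddSubgroup.closure {x : F | x ^ k = 1} = ⊤ := by
  let M : Submonoid F :=
    { carrier := {x | x ^ k = 1}
      one_mem' := one_pow k
      mul_mem' := fun {a b} (ha : a ^ k = 1) (hb : b ^ k = 1) => by
        simp [mul_pow, ha, hb] }
  obtain ⟨a, ha, hcard, hpow⟩ := (Subring.closure (M : Set F)).exists_card_eq_pow p
  have hp : 1 < p := (Fact.out : p.Prime).one_lt
  obtain ⟨ζ, hζ⟩ := exists_isPrimitiveRoot_of_dvd (F := F) (k := k) (by rw [hF]; exact hk.1)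
  -- The subring contains an element of order `k`, so primitivity of `k` forces its order to be at
  -- least `p ^ n`.
  have hdvd : k ∣ p ^ a - 1 := by
    rw [← hζ.pow_eq_one_iff_dvd]
    have hk0 : 0 < k := Nat.pos_of_dvd_of_pos hk.1 (by
      rw [← hF]; exact Nat.sub_pos_of_lt Finite.one_lt_card)
    have h0 : ζ ≠ 0 := hζ.ne_zero hk0.ne'
    refine mul_left_cancel₀ h0 ?_
    rw [mul_one, ← pow_succ', Nat.sub_add_cancel (Nat.one_le_pow _ _ (by omega))]
    exact hpow ζ (Subring.subset_closure hζ.pow_eq_one)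
  have hna : n ≤ a := by
    by_contra h
    exact hk.2 a ha (by omega) hdvd
  have htop : (Subring.closure (M : Set F) : Set F) = Set.univ := by
    refine Set.eq_univ_of_univ_subset (Set.eq_of_subset_of_ncard_le (Set.subset_univ _) ?_
      (Set.toFinite _)).ge
    rw [Set.ncard_univ, hF, ← Nat.card_coe_set_eq]
    exact (Nat.pow_le_pow_right (by omega) hna).trans hcard.ge
  refine (AddSubgroup.eq_top_iff' _).2 fun x => ?_
  have hx : x ∈ Subring.closure (M : Set F) := by
    rw [← SetLike.mem_coe, htop]; trivial
  rwa [Subring.mem_closure_iff, Submonoid.closure_eq] at hx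

/-- Elements with `x ^ p ^ a = x` span an additive subgroup of order at most `p ^ a`. -/
theorem card_closure_le_of_pow_eq_self {p : ℕ} [Fact p.Prime] [CharP F p] {a : ℕ} (ha : 0 < a) {s : Set F}
    (hs : ∀ x ∈ s, x ^ p ^ a = x) : Nat.card (AddSubgroup.closure s) ≤ p ^ a := by
  classical
  have hp : 1 < p := (Fact.out : p.Prime).one_lt
  -- The condition is additive by Frobenius, so the whole span consists of roots of `X ^ p ^ a - X`.
  have hle : ∀ x ∈ AddSubgroup.closure s, x ^ p ^ a = x := by
    intro x hx
    induction hx using AddSubgroup.closure_induction with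
    | mem x hx => exact hs x hx
    | zero => exact zero_pow (pow_pos (by omega) a).ne'
    | add x y _ _ hx hy => rw [add_pow_char_pow, hx, hy]
    | neg x _ hx =>
      have := sub_pow_char_pow (p := p) (n := a) (0 : F) x
      rwa [zero_sub, zero_pow (pow_pos (by omega) a).ne', hx, zero_sub] at this
  have hpoly : (Polynomial.X ^ p ^ a - Polynomial.X : Polynomial F) ≠ 0 :=
    FiniteField.X_pow_card_pow_sub_X_ne_zero F ha.ne' hp
  calc Nat.card (AddSubgroup.closure s)
      ≤ Nat.card ((Polynomial.X ^ p ^ a - Polynomial.X : Polynomial F).roots.toFinset : Set F) := by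
        refine Nat.card_mono (Set.toFinite _) fun x hx => ?_
        simp [hpoly, hle x hx]
    _ ≤ p ^ a := by
        rw [Nat.card_coe_set_eq, Set.ncard_coe_finset]
        refine (Multiset.toFinset_card_le _).trans ((Polynomial.card_roots' _).trans ?_)
        rw [FiniteField.X_pow_card_pow_sub_X_natDegree_eq F ha.ne' hp]

end field

/-! ### Generalised Paley graphs as Cayley graphs and as Cartesian powers -/

section gPaley

variable {p n k : ℕ} [Fact p.Prime]

theorem IsGPaleyParameter.pos_right (h : IsGPaleyParameter p n k) : 0 < k :=
  Nat.pos_of_dvd_of_pos h.dvd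
    (Nat.sub_pos_of_lt (Nat.one_lt_pow h.pos.ne' (Fact.out : p.Prime).one_lt))

/-- The multiplicative group is cyclic of order `k * d`, so its `d`-th powers are exactly the `k`-th
roots of unity. -/
theorem gPaley_adj (h : IsGPaleyParameter p n k) {x y : GaloisField p n} :
    (gPaley p n k h).Adj x y ↔ (x - y) ^ k = 1 := by
  have hcard := GaloisField.card p n h.pos.ne'
  have := Fintype.ofFinite (GaloisField p n)
  obtain ⟨d, hd⟩ := h.dvd
  have hk := h.pos_right
  have hdpos : 0 < d := by
    rcases Nat.eq_zero_or_pos d with rfl | hd'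
    · have := Nat.one_lt_pow h.pos.ne' (Fact.out : p.Prime).one_lt
      omega
    · exact hd'
  have hq : (p ^ n - 1) / k = d := by rw [hd, Nat.mul_div_cancel_left _ hk]
  change (∃ a, a ≠ 0 ∧ a ^ ((p ^ n - 1) / k) = x - y) ↔ _
  rw [hq]
  constructor
  · rintro ⟨a, ha, hxy⟩
    rw [← hxy, ← pow_mul, mul_comm d k, ← hd, ← hcard, Nat.card_eq_fintype_card]
    exact FiniteField.pow_card_sub_one_eq_one a ha
  · intro hxy
    obtain ⟨ζ, hζ⟩ := exists_isPrimitiveRoot_of_dvd (F := GaloisField p n) (k := k * d)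
      (by rw [hcard, hd])
    have : NeZero k := ⟨hk.ne'⟩
    have hζk := hζ.pow (Nat.mul_pos hk hdpos) (mul_comm k d)
    obtain ⟨i, -, hi⟩ := hζk.eq_pow_of_pow_eq_one hxy
    refine ⟨ζ ^ i, pow_ne_zero _ (hζ.ne_zero (Nat.mul_pos hk hdpos).ne'), ?_⟩
    rw [← hi, ← pow_mul, ← pow_mul, mul_comm]

theorem gPaley_connected (h : IsGPaleyParameter p n k) (hk : IsPrimitiveDivisor p n k) :
    (gPaley p n k h).Connected := by
  have key : ∀ x : GaloisField p n, (gPaley p n k h).Reachable 0 x := by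
    intro x
    have hx : x ∈ AddSubgroup.closure {x : GaloisField p n | x ^ k = 1} := by
      rw [hk.closure_eq_top (GaloisField.card p n h.pos.ne')]; trivial
    induction hx using AddSubgroup.closure_induction_right with
    | zero => rfl
    | add_right x hx s hs ih =>
      refine ih.trans (SimpleGraph.Adj.reachable (SimpleGraph.Adj.symm ?_))
      rw [gPaley_adj, add_sub_cancel_left]; exact hs
    | add_neg_cancel x hx s hs ih =>
      refine ih.trans (SimpleGraph.Adj.reachable ?_)
      rw [gPaley_adj, sub_add_cancel_left, neg_neg]; exact hs
  exact (SimpleGraph.connected_iff _).2 ⟨fun x y => (key x).symm.trans (key y), inferInstance⟩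

/-- If `k = b * c` is a primitive divisor of `p ^ n - 1` and `c` divides `p ^ (n / b) - 1`, then the
generalised Paley graph is a Cartesian power. -/
theorem gPaley_iso_cartesianPower (h : IsGPaleyParameter p n k) (hk : IsPrimitiveDivisor p n k)
    {b c : ℕ} (hbc : k = b * c) (hb : b ∣ n) (hc : c ∣ p ^ (n / b) - 1) :
    ∃ h₀ : IsGPaleyParameter p (n / b) c,
      Nonempty (gPaley p n k h ≃g cartesianPower b (gPaley p (n / b) c h₀)) := by
  classical
  have hp : p.Prime := Fact.out
  have hkpos := h.pos_right
  have hbpos : 0 < b := Nat.pos_of_mul_pos_right (hbc ▸ hkpos)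
  have hcpos : 0 < c := Nat.pos_of_mul_pos_left (hbc ▸ hkpos)
  obtain ⟨e, rfl⟩ := hb
  rw [Nat.mul_div_cancel_left _ hbpos] at hc ⊢
  have hepos : 0 < e := Nat.pos_of_mul_pos_left h.pos
  have hcardF := GaloisField.card p (b * e) h.pos.ne'
  have hcardL := GaloisField.card p e hepos.ne'
  obtain ⟨ι⟩ := FiniteField.nonempty_algHom_of_finrank_dvd (F := ZMod p) (K := GaloisField p e)
    (L := GaloisField p (b * e)) (by
      rw [GaloisField.finrank p hepos.ne', GaloisField.finrank p h.pos.ne']; exact dvd_mul_left _ _)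
  obtain ⟨g, hg⟩ := exists_isPrimitiveRoot_of_dvd (F := GaloisField p (b * e)) (k := k)
    (by rw [hcardF]; exact h.dvd)
  obtain ⟨ζ, hζ⟩ := exists_isPrimitiveRoot_of_dvd (F := GaloisField p e) (k := c)
    (by rw [hcardL]; exact hc)
  have hιζ : IsPrimitiveRoot (ι ζ) c := hζ.map_of_injective ι.injective
  have : NeZero k := ⟨hkpos.ne'⟩
  have : NeZero c := ⟨hcpos.ne'⟩
  let f : (Fin b → GaloisField p e) →+ GaloisField p (b * e) :=
    { toFun := fun z => ∑ i, ι (z i) * g ^ (i : ℕ)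
      map_zero' := by simp
      map_add' := fun x y => by simp [add_mul, Finset.sum_add_distrib] }
  have hfs : ∀ i a, f (Pi.single i a) = ι a * g ^ (i : ℕ) := by
    intro i a
    change ∑ j, ι (Pi.single (M := fun _ => GaloisField p e) i a j) * g ^ (j : ℕ) = _
    rw [Finset.sum_eq_single i]
    · simp
    · intro j _ hj; simp [hj]
    · simp
  -- every `k`-th root of unity is the image of a `c`-th root of unity in some coordinate
  have hroot : ∀ s : GaloisField p (b * e), s ^ k = 1 →
      ∃ i a, a ^ c = 1 ∧ s = f (Pi.single i a) := by
    intro s hs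
    obtain ⟨j, -, rfl⟩ := hg.eq_pow_of_pow_eq_one hs
    -- Split `g ^ j` as `g ^ (b * (j / b)) * g ^ (j % b)`: the first factor is a `c`-th root of
    -- unity, hence in the subfield, and `j % b` is the coordinate.
    obtain ⟨l, -, hl⟩ := hιζ.eq_pow_of_pow_eq_one (ξ := g ^ (b * (j / b))) (by
      rw [← pow_mul, show b * (j / b) * c = k * (j / b) by rw [hbc]; ring, pow_mul, hg.pow_eq_one,
        one_pow])
    refine ⟨⟨j % b, Nat.mod_lt _ hbpos⟩, ζ ^ l, ?_, ?_⟩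
    · rw [← pow_mul, mul_comm, pow_mul, hζ.pow_eq_one, one_pow]
    · rw [hfs, map_pow, hl, ← pow_add, Nat.div_add_mod]
  have hsurj : Function.Surjective f := by
    have htop : f.range = ⊤ := by
      rw [eq_top_iff, ← hk.closure_eq_top hcardF, AddSubgroup.closure_le]
      intro s hs
      obtain ⟨i, a, -, rfl⟩ := hroot s hs
      exact ⟨_, rfl⟩
    exact AddMonoidHom.range_eq_top.1 htop
  have hbij : Function.Bijective f := by
    refine (Nat.bijective_iff_surjective_and_card f).2 ⟨hsurj, ?_⟩
    rw [Nat.card_fun, hcardF, hcardL, Nat.card_eq_fintype_card, Fintype.card_fin, ← pow_mul,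
      mul_comm]
  -- Since `k` is even, -1 is a `k`-th root of unity; injectivity of `f` puts it in coordinate 0, so
  -- `(-1) ^ c = 1` in odd characteristic.
  have heven : Odd p → Even c := by
    intro hodd
    obtain ⟨i, a, ha, hs⟩ := hroot (-1) ((h.even hodd).neg_one_pow)
    have h1 : (-1 : GaloisField p (b * e)) = f (Pi.single ⟨0, hbpos⟩ (-1)) := by
      rw [hfs]; simp
    have h2 := hbij.1 (h1.symm.trans hs)
    have h3 : (-1 : GaloisField p e) = a := by
      have h4 := congrFun h2 ⟨0, hbpos⟩
      rw [Pi.single_eq_same] at h4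
      by_cases hi : i = ⟨0, hbpos⟩
      · rw [hi, Pi.single_eq_same] at h4; exact h4
      · rw [Pi.single_eq_of_ne (Ne.symm hi)] at h4
        exact absurd h4 (neg_ne_zero.2 one_ne_zero)
    rw [← h3] at ha
    by_contra hc'
    rw [(Nat.not_even_iff_odd.1 hc').neg_one_pow] at ha
    have : Fact (2 < p) := ⟨lt_of_le_of_ne hp.two_le fun h => by subst h; exact absurd hodd (by decide)⟩
    exact CharP.neg_one_ne_one (GaloisField p e) p ha
  have h₀ : IsGPaleyParameter p e c := ⟨hepos, hc, heven⟩
  refine ⟨h₀, ⟨RelIso.symm ⟨Equiv.ofBijective f hbij, ?_⟩⟩⟩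
  intro x y
  change (gPaley p (b * e) k h).Adj (f x) (f y) ↔ _
  rw [gPaley_adj, ← map_sub]
  constructor
  · intro hxy
    obtain ⟨i, a, ha, hs⟩ := hroot _ hxy
    have hsub := hbij.1 hs
    refine ⟨i, (gPaley_adj h₀).2 ?_, fun j hj => ?_⟩
    · rw [← Pi.sub_apply, hsub, Pi.single_eq_same, ha]
    · rw [← sub_eq_zero, ← Pi.sub_apply, hsub, Pi.single_eq_of_ne hj]
  · rintro ⟨i, hi, hne⟩
    have hsub : x - y = Pi.single i (x i - y i) := by
      funext j
      by_cases hj : j = i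
      · subst hj; simp
      · rw [Pi.single_eq_of_ne hj, Pi.sub_apply, hne j hj, sub_self]
    have hi' := (gPaley_adj h₀).1 hi
    rw [hsub, hfs, mul_pow, ← map_pow, ← pow_mul, mul_comm (i : ℕ), pow_mul, hg.pow_eq_one, one_pow,
      mul_one, hbc, mul_comm b c, pow_mul, hi', one_pow, map_one]

end gPaley

/-! ### Comparison of factors and the action on directions -/

namespace SameLayer

section layerIso

variable {V : Type u} {G : SimpleGraph V} {ι κ : Type*}
  {W : ι → Type u} {Δ : ∀ i, SimpleGraph (W i)} {X : κ → Type u} {E : ∀ j, SimpleGraph (X j)}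

theorem nonempty_iso {φ : G ≃g cartesianProduct Δ} {ψ : G ≃g cartesianProduct E} {i : ι} {j : κ}
    {x : V} (h : ∀ y, SameLayer φ i x y ↔ SameLayer ψ j x y) : Nonempty (Δ i ≃g E j) := by
  classical
  have e : {y | SameLayer φ i x y} = {y | SameLayer ψ j x y} := Set.ext h
  exact ⟨(induceIso φ i x).trans ((e ▸ SimpleGraph.Iso.refl :
    G.induce {y | SameLayer φ i x y} ≃g G.induce {y | SameLayer ψ j x y}).trans
      (induceIso ψ j x).symm)⟩

/-- A Cartesian-prime factor is isomorphic to a factor of any factorization into graphs of the same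
order. -/
theorem nonempty_iso_of_card_eq [Finite V] [Finite ι] [Finite κ] (hG : G.Connected)
    (hW : ∀ i, Nonempty (W i)) (hX : ∀ j, Nonempty (X j))
    (φ : G ≃g cartesianProduct Δ) (ψ : G ≃g cartesianProduct E) (i : ι)
    (hi : IsCartesianPrime (Δ i)) (hcard : ∀ j, Nat.card (W i) = Nat.card (X j)) :
    ∃ j, Nonempty (Δ i ≃g E j) := by
  classical
  obtain ⟨x⟩ := hG.nonempty
  obtain ⟨j, hj⟩ := exists_le hG hW hX φ ψ i hi x
  have hle : {y | SameLayer ψ j x y}.ncard ≤ {y | SameLayer φ i x y}.ncard := by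
    rw [← Nat.card_coe_set_eq, ← Nat.card_coe_set_eq]
    exact ((Nat.card_congr (induceIso ψ j x).toEquiv).symm.trans
      ((hcard j).symm.trans (Nat.card_congr (induceIso φ i x).toEquiv))).le
  exact ⟨j, nonempty_iso (φ := φ) (ψ := ψ) (x := x)
    (Set.ext_iff.1 (Set.eq_of_subset_of_ncard_le hj hle (Set.toFinite _)))⟩

/-- A group of automorphisms of a connected graph permutes the directions of a factorization into
Cartesian-prime graphs. -/
theorem exists_mulAction [Finite ι] (hG : G.Connected) (hΔ : ∀ i, IsCartesianPrime (Δ i))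
    (φ : G ≃g cartesianProduct Δ) (A : Type*) [Group A] [MulAction A V]
    (hA : ∀ (a : A) x y, G.Adj x y → G.Adj (a • x) (a • y)) :
    ∃ _ : MulAction A ι, ∀ (a : A) i x y,
      SameLayer φ i x y ↔ SameLayer φ (a • i) (a • x) (a • y) := by
  have hW : ∀ i, Nontrivial (W i) := fun i => (hΔ i).1
  let α : A → (G ≃g G) := fun a => ⟨MulAction.toPerm a, by
    intro x y
    refine ⟨fun h => ?_, hA a x y⟩
    simpa using hA a⁻¹ _ _ h⟩
  choose π hπ using fun (a : A) (i : ι) =>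
    exists_forall_iff hG hΔ hΔ φ ((α a).trans φ) i
  have hπ' : ∀ a i x y, SameLayer φ i x y ↔ SameLayer φ (π a i) (a • x) (a • y) :=
    fun a i x y => (hπ a i x y).trans comp_iso
  -- A direction is determined by its layers, which forces the action laws.
  have huniq : ∀ i j, (∀ x y, SameLayer φ i x y → SameLayer φ j x y) → i = j := by
    intro i j h
    obtain ⟨x⟩ := hG.nonempty
    obtain ⟨y, hyx, hy⟩ := exists_ne φ i x
    exact eq_index hyx.symm hy (h x y hy)
  have hone : ∀ i, π 1 i = i := fun i =>
    (huniq _ _ fun x y h => by simpa using (hπ' 1 i x y).1 h).symm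
  have hmul : ∀ a a' i, π (a * a') i = π a (π a' i) := fun a a' i =>
    huniq _ _ fun x y h => by
      have h1 := hπ' (a * a') i ((a * a')⁻¹ • x) ((a * a')⁻¹ • y)
      have h2 := hπ' a (π a' i) (a' • (a * a')⁻¹ • x) (a' • (a * a')⁻¹ • y)
      rw [← hπ', smul_smul, smul_smul, smul_smul, smul_smul, mul_inv_cancel, one_smul,
        one_smul] at h2
      rw [smul_inv_smul, smul_inv_smul] at h1
      exact h2.1 (h1.2 h)
  exact ⟨{ smul := π, one_smul := hone, mul_smul := hmul }, hπ'⟩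

end layerIso

end SameLayer

/-! ### From a prime factorization to a subfield -/

/-- The parameters of a factorization of a generalised Paley graph into Cartesian-prime graphs. -/
theorem gPaley_prime_factorization {p n k : ℕ} [Fact p.Prime] (h : IsGPaleyParameter p n k)
    (hk : IsPrimitiveDivisor p n k) {ι : Type*} [Finite ι] {W : ι → Type}
    {Δ : ∀ i, SimpleGraph (W i)} (hΔ : ∀ i, IsCartesianPrime (Δ i))
    (φ : gPaley p n k h ≃g cartesianProduct Δ) :
    ∃ c, k = Nat.card ι * c ∧ Nat.card ι ∣ n ∧ IsPrimitiveDivisor p (n / Nat.card ι) c ∧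
      ∀ i, Nat.card (W i) = p ^ (n / Nat.card ι) := by
  classical
  have hp : p.Prime := Fact.out
  have hW : ∀ i, Nontrivial (W i) := fun i => (hΔ i).1
  have hG := gPaley_connected h hk
  have hkpos := h.pos_right
  have : NeZero k := ⟨hkpos.ne'⟩
  have hcardF := GaloisField.card p n h.pos.ne'
  have hΔc := SameLayer.connected_factor hG (fun i => inferInstance) φ
  obtain ⟨actT, hT⟩ := SameLayer.exists_mulAction hG hΔ φ (Multiplicative (GaloisField p n))
    fun a x y hxy => by
      rw [gPaley_adj] at hxy ⊢
      change ((a.toAdd + x) - (a.toAdd + y)) ^ k = 1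
      rwa [add_sub_add_left_eq_sub]
  let S := rootsOfUnity k (GaloisField p n)
  have hSpow : ∀ s : S, ((s : (GaloisField p n)ˣ) : GaloisField p n) ^ k = 1 := fun s =>
    (mem_rootsOfUnity' k _).1 s.2
  have hsmul : ∀ (s : S) (x : GaloisField p n),
      s • x = ((s : (GaloisField p n)ˣ) : GaloisField p n) * x := fun s x => rfl
  obtain ⟨actS, hS⟩ := SameLayer.exists_mulAction hG hΔ φ S
    fun s x y hxy => by
      rw [gPaley_adj] at hxy ⊢
      rw [hsmul, hsmul, ← mul_sub, mul_pow, hxy, hSpow, one_mul]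
  have hunit : ∀ x : GaloisField p n, x ^ k = 1 →
      ∃ s : S, ((s : (GaloisField p n)ˣ) : GaloisField p n) = x := fun x hx =>
    ⟨rootsOfUnity.mkOfPowEq x hx, rootsOfUnity.coe_mkOfPowEq hx⟩
  obtain ⟨i₀, hi₀⟩ := SameLayer.exists_of_adj φ (x := (0 : GaloisField p n)) (y := 1)
    (SimpleGraph.Adj.symm ((gPaley_adj h).2 (by simp)))
  have hindex : ∀ (s : S) i, SameLayer φ i 0 ((s : (GaloisField p n)ˣ) : GaloisField p n) →
      s • i₀ = i := by
    intro s i hi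
    have h1 := (hS s i₀ 0 1).1 hi₀
    rw [hsmul, hsmul, mul_zero, mul_one] at h1
    exact SameLayer.eq_index (Units.ne_zero _).symm h1 hi
  -- A layer through 0 is connected and nontrivial, so it contains a neighbour of 0, that is, a root
  -- of unity; multiplication by it moves the edge from 0 to 1 into that layer.
  have htrans : ∀ i, ∃ s : S, s • i₀ = i := by
    intro i
    by_contra hcon
    push Not at hcon
    obtain ⟨y, hy0, hy⟩ := SameLayer.exists_ne φ i 0
    refine hy0 (SameLayer.induction hΔc i 0 (P := fun y => y = 0) rfl ?_ y hy)
    rintro _ z - hz hadj rfl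
    obtain ⟨s, rfl⟩ := hunit z (by
      have := (gPaley_adj h).1 hadj.symm; rwa [sub_zero] at this)
    exact absurd (hindex s i hz) (hcon s)
  have hScard : Nat.card S = k := by
    obtain ⟨ζ, hζ⟩ := exists_isPrimitiveRoot_of_dvd (F := GaloisField p n) (k := k)
      (by rw [hcardF]; exact h.dvd)
    exact hζ.card_rootsOfUnity
  let C := MulAction.stabilizer S i₀
  have hbc : k = Nat.card ι * Nat.card C := by
    have horb : MulAction.orbit S i₀ = Set.univ := Set.eq_univ_of_forall htrans
    have := C.card_mul_index
    rw [MulAction.index_stabilizer, horb, Set.ncard_univ, hScard] at this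
    rw [← this, mul_comm]
  have hbpos : 0 < Nat.card ι := Nat.pos_of_mul_pos_right (hbc ▸ hkpos)
  have hpb : ¬ p ∣ Nat.card ι := by
    intro hdvd
    have h1 : p ∣ p ^ n - 1 := hdvd.trans ((Dvd.intro _ hbc.symm).trans h.dvd)
    have h2 := (Nat.dvd_sub_iff_right (Nat.one_le_pow n p hp.pos) (dvd_pow_self p h.pos.ne')).1 h1
    exact hp.one_lt.ne' (Nat.dvd_one.1 h2)
  obtain ⟨i₁, hi₁⟩ := (IsPGroup.of_card (p := p) (n := n)
    (G := Multiplicative (GaloisField p n)) hcardF).nonempty_fixed_point_of_prime_not_dvd_card ι hpb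
  -- Conjugating by a root of unity that carries `i₁` to `i` turns a translation fixing `i₁` into
  -- one fixing `i`.
  have htransl : ∀ i v x y, SameLayer φ i x y ↔ SameLayer φ i (v + x) (v + y) := by
    intro i v x y
    obtain ⟨s, rfl⟩ : ∃ s : S, s • i₁ = i := by
      obtain ⟨t, rfl⟩ := htrans i
      obtain ⟨r, rfl⟩ := htrans i₁
      exact ⟨t * r⁻¹, by rw [mul_smul, inv_smul_smul]⟩
    have key := hT (Multiplicative.ofAdd (s⁻¹ • v)) i₁ (s⁻¹ • x) (s⁻¹ • y)
    rw [hi₁] at key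
    rw [hS s i₁, hS s i₁] at key
    have hact : ∀ z, s • (Multiplicative.ofAdd (s⁻¹ • v) • (s⁻¹ • z)) = v + z := by
      intro z
      change s • (s⁻¹ • v + s⁻¹ • z) = v + z
      rw [smul_add, smul_inv_smul, smul_inv_smul]
    rwa [hact, hact, smul_inv_smul, smul_inv_smul] at key
  let H : AddSubgroup (GaloisField p n) :=
    { carrier := {x | SameLayer φ i₀ 0 x}
      zero_mem' := SameLayer.refl φ i₀ 0
      add_mem' := fun {x y} hx hy => by
        have := (htransl i₀ x 0 y).1 hy
        rw [add_zero] at this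
        exact SameLayer.trans hx this
      neg_mem' := fun {x} hx => by
        have := (htransl i₀ (-x) 0 x).1 hx
        rw [add_zero, neg_add_cancel] at this
        exact this.symm }
  let D : Set (GaloisField p n) := {x | x ^ k = 1 ∧ SameLayer φ i₀ 0 x}
  -- Along a path inside the layer, successive differences are roots of unity lying in `H`.
  have hHD : H = AddSubgroup.closure D := by
    apply le_antisymm
    · intro x hx
      refine SameLayer.induction hΔc i₀ 0 (P := fun y => y ∈ AddSubgroup.closure D)
        (zero_mem _) ?_ x hx
      intro y z hy hz hadj hyD
      have hd : y - z ∈ D := ⟨(gPaley_adj h).1 hadj, H.sub_mem hy hz⟩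
      have := sub_mem hyD (AddSubgroup.subset_closure hd)
      rwa [sub_sub_cancel] at this
    · rw [AddSubgroup.closure_le]
      exact fun x hx => hx.2
  -- A root of unity in `H` fixes the direction `i₀` and the vertex 0, so multiplication by it
  -- preserves `H`; additivity extends this to the span.
  have hmul : ∀ {x y}, x ∈ H → y ∈ H → x * y ∈ H := by
    intro x y hx hy
    rw [hHD] at hx
    induction hx using AddSubgroup.closure_induction with
    | mem x hx =>
      obtain ⟨s, rfl⟩ := hunit x hx.1
      have h1 := (hS s i₀ 0 y).1 hy
      rwa [hindex s i₀ hx.2, hsmul, hsmul, mul_zero] at h1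
    | zero => rw [zero_mul]; exact H.zero_mem
    | add a b _ _ ha hb => rw [add_mul]; exact H.add_mem ha hb
    | neg a _ ha => rw [neg_mul]; exact H.neg_mem ha
  let A : Subring (GaloisField p n) := { H with one_mem' := hi₀, mul_mem' := hmul }
  obtain ⟨e, hepos, hAcard, hApow⟩ := A.exists_card_eq_pow p
  have hWcard : ∀ i, Nat.card (W i) = p ^ e := by
    intro i
    obtain ⟨s, rfl⟩ := htrans i
    rw [← hAcard, Nat.card_congr (SameLayer.induceIso φ (s • i₀) 0).toEquiv]
    refine (Nat.card_congr (Equiv.subtypeEquiv (MulAction.toPerm s) fun x => ?_)).symm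
    have := hS s i₀ 0 x
    rwa [hsmul s 0, mul_zero] at this
  have hne : n = Nat.card ι * e := by
    have := Fintype.ofFinite ι
    have h1 := Nat.card_congr φ.toEquiv
    rw [Nat.card_pi, Finset.prod_congr rfl fun i _ => hWcard i, Finset.prod_const, hcardF,
      Finset.card_univ, ← Nat.card_eq_fintype_card, ← pow_mul] at h1
    rw [Nat.pow_right_injective hp.two_le h1, mul_comm]
  have hdiv : n / Nat.card ι = e := by
    conv_lhs => rw [hne]
    exact Nat.mul_div_cancel_left _ hbpos
  refine ⟨Nat.card C, hbc, Dvd.intro _ hne.symm, ?_, fun i => by rw [hdiv, hWcard]⟩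
  rw [hdiv]
  have hCD : ∀ s : S, s ∈ C ↔ ((s : (GaloisField p n)ˣ) : GaloisField p n) ∈ D := by
    intro s
    refine ⟨fun hs => ⟨hSpow s, ?_⟩, fun hs => hindex s i₀ hs.2⟩
    have h1 := (hS s i₀ 0 1).1 hi₀
    rwa [MulAction.mem_stabilizer_iff.1 hs, hsmul, hsmul, mul_zero, mul_one] at h1
  have hDpow : ∀ x ∈ D, x ^ Nat.card C = 1 := by
    intro x hx
    obtain ⟨s, rfl⟩ := hunit x hx.1
    have h1 : (⟨s, (hCD s).2 hx⟩ : C) ^ Nat.card C = 1 := pow_card_eq_one'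
    exact congrArg (fun t : C => (((t : S) : (GaloisField p n)ˣ) : GaloisField p n)) h1
  constructor
  · rw [← IsCyclic.exponent_eq_card, Monoid.exponent_dvd_iff_forall_pow_eq_one]
    intro s
    have hs := hApow (((s : S) : (GaloisField p n)ˣ) : GaloisField p n) ((hCD s).1 s.2).2
    refine Subtype.ext (Subtype.ext (Units.ext ?_))
    change (((s : S) : (GaloisField p n)ˣ) : GaloisField p n) ^ (p ^ e - 1) = 1
    refine mul_left_cancel₀ (Units.ne_zero ((s : S) : (GaloisField p n)ˣ)) ?_
    rw [mul_one, ← pow_succ', Nat.sub_add_cancel (Nat.one_le_pow _ _ hp.pos), hs]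
  -- If `c` divided `p ^ a - 1` with `a < e`, the span `H` of `D` would have at most `p ^ a`
  -- elements.
  · intro a ha hae ⟨d, hd⟩
    have h1 := card_closure_le_of_pow_eq_self (p := p) ha (s := D) fun x hx => by
      rw [← Nat.sub_add_cancel (Nat.one_le_pow a p hp.pos), pow_succ, hd, pow_mul, hDpow x hx,
        one_pow, one_mul]
    rw [← hHD] at h1
    exact absurd (h1.trans_lt (Nat.pow_lt_pow_right hp.one_lt hae)) (hAcard.symm.le.not_gt)

/-! ### The main theorem -/

theorem theorem1p1 (p n k : ℕ) [Fact p.Prime] (hΓ : IsGPaleyParameter p n k)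
    (hk : IsPrimitiveDivisor p n k) :
    (gPaley p n k hΓ).Connected ∧
    -- the equivalence of (a), (b) and (c)
    List.TFAE
      [IsCartesianDecomposable (gPaley p n k hΓ),
       ∃ b c : ℕ, k = b * c ∧ 1 < b ∧ b ∣ n ∧ IsPrimitiveDivisor p (n / b) c,
       ∃ b c : ℕ, (k = b * c ∧ 1 < b ∧ b ∣ n ∧ IsPrimitiveDivisor p (n / b) c) ∧
         ∃ h₀ : IsGPaleyParameter p (n / b) c,
           Nonempty (gPaley p n k hΓ ≃g cartesianPower b (gPaley p (n / b) c h₀))] ∧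
    -- the isomorphism in (c) holds for every pair `b, c` as in (b)
    (∀ b c : ℕ, k = b * c → 1 < b → b ∣ n → IsPrimitiveDivisor p (n / b) c →
      ∃ h₀ : IsGPaleyParameter p (n / b) c,
        Nonempty (gPaley p n k hΓ ≃g cartesianPower b (gPaley p (n / b) c h₀))) ∧
    -- the Cartesian-prime factors are all isomorphic to one smaller generalised Paley graph
    (IsCartesianDecomposable (gPaley p n k hΓ) →
      ∃ b c : ℕ, (k = b * c ∧ 1 < b ∧ b ∣ n ∧ IsPrimitiveDivisor p (n / b) c) ∧
        ∃ h₀ : IsGPaleyParameter p (n / b) c,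
          IsCartesianPrime (gPaley p (n / b) c h₀) ∧
          Nonempty (gPaley p n k hΓ ≃g cartesianPower b (gPaley p (n / b) c h₀)) ∧
          ∀ (m : ℕ) (W : Fin m → Type) (Δ : ∀ i, SimpleGraph (W i)),
            (∀ i, IsCartesianPrime (Δ i)) → Nonempty (gPaley p n k hΓ ≃g cartesianProduct Δ) →
            ∀ i, Nonempty (Δ i ≃g gPaley p (n / b) c h₀)) := by
  have hG := gPaley_connected hΓ hk
  have hpower : ∀ b c : ℕ, k = b * c → 1 < b → b ∣ n → IsPrimitiveDivisor p (n / b) c →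
      ∃ h₀ : IsGPaleyParameter p (n / b) c,
        Nonempty (gPaley p n k hΓ ≃g cartesianPower b (gPaley p (n / b) c h₀)) :=
    fun b c hbc _ hb hc => gPaley_iso_cartesianPower hΓ hk hbc hb hc.1
  have hprime : IsCartesianDecomposable (gPaley p n k hΓ) →
      ∃ b c : ℕ, (k = b * c ∧ 1 < b ∧ b ∣ n ∧ IsPrimitiveDivisor p (n / b) c) ∧
        ∃ h₀ : IsGPaleyParameter p (n / b) c,
          IsCartesianPrime (gPaley p (n / b) c h₀) ∧
          Nonempty (gPaley p n k hΓ ≃g cartesianPower b (gPaley p (n / b) c h₀)) ∧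
          ∀ (m : ℕ) (W : Fin m → Type) (Δ : ∀ i, SimpleGraph (W i)),
            (∀ i, IsCartesianPrime (Δ i)) → Nonempty (gPaley p n k hΓ ≃g cartesianProduct Δ) →
            ∀ i, Nonempty (Δ i ≃g gPaley p (n / b) c h₀) := by
    intro hd
    have : Nontrivial (GaloisField p n) := inferInstance
    obtain ⟨b, W, Δ, hΔ, ⟨φ⟩⟩ := exists_prime_factorization (gPaley p n k hΓ)
    have hW : ∀ i, Nontrivial (W i) := fun i => (hΔ i).1
    obtain ⟨c, hbc, hbn, hc, hcard⟩ := gPaley_prime_factorization hΓ hk hΔ φ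
    rw [Nat.card_eq_fintype_card, Fintype.card_fin] at hbc hbn hc hcard
    have hb0 : b ≠ 0 := by
      rintro rfl
      exact hΓ.pos_right.ne' (by rw [hbc, zero_mul])
    have hb1 : b ≠ 1 := by
      rintro rfl
      refine (hΔ 0).2 (hd.of_iso (RelIso.symm (φ.trans ⟨Equiv.piUnique W, ?_⟩)))
      intro x y
      refine ⟨fun hxy => ⟨0, hxy, fun j hj => absurd (Subsingleton.elim j 0) hj⟩, ?_⟩
      rintro ⟨i, hi, -⟩
      obtain rfl := Subsingleton.elim i 0
      exact hi
    have hb : 1 < b := by omega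
    obtain ⟨h₀, ⟨ψ⟩⟩ := hpower b c hbc hb hbn hc
    -- Primality of the smaller Paley graph is not yet known: a layer of the prime factor lies in a
    -- layer of the power, and equal orders make them coincide. Primality is then inherited from
    -- `Δ`.
    have hiso : ∀ i, Nonempty (Δ i ≃g gPaley p (n / b) c h₀) := by
      intro i
      obtain ⟨_, hj⟩ := SameLayer.nonempty_iso_of_card_eq
        (E := fun _ : Fin b => gPaley p (n / b) c h₀) hG (fun i => inferInstance)
        (fun _ => inferInstance) φ ψ i (hΔ i) fun _ => by
          rw [hcard, GaloisField.card p _ h₀.pos.ne']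
      exact hj
    have hpr : IsCartesianPrime (gPaley p (n / b) c h₀) :=
      (hΔ ⟨0, by omega⟩).of_iso (hiso _).some
    refine ⟨b, c, ⟨hbc, hb, hbn, hc⟩, h₀, hpr, ⟨ψ⟩, ?_⟩
    rintro m X E hE ⟨χ⟩ i
    obtain ⟨_, hj⟩ := SameLayer.exists_iff (E := fun _ : Fin b => gPaley p (n / b) c h₀) hG hE
      (fun _ => hpr) χ ψ i 0
    exact SameLayer.nonempty_iso hj
  refine ⟨hG, ?_, hpower, hprime⟩
  tfae_have 1 → 2 := fun hd => by
    obtain ⟨b, c, hbc, -⟩ := hprime hd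
    exact ⟨b, c, hbc⟩
  tfae_have 2 → 3 := fun ⟨b, c, hbc, hb, hbn, hc⟩ =>
    ⟨b, c, ⟨hbc, hb, hbn, hc⟩, hpower b c hbc hb hbn hc⟩
  tfae_have 3 → 1 := by
    rintro ⟨b, c, ⟨-, hb, -⟩, h₀, hφ⟩
    exact ⟨b, hb, _, _, fun _ => inferInstance, hφ⟩
  tfae_finish
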